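/- Let $G$ be a finite simple graph that is not complete (so it has $n\ge 2$ vertices), let $A$ be its adjacency matrix and $D$ the diagonal matrix of its degrees, and let $q_1(G)\ge q_2(G)\ge\dots\ge q_n(G)$ be the eigenvalues, with multiplicity, of the signless Laplacian $Q(G)=A+D$. Let $\delta(G)$ be the minimum degree of $G$. Then \[ q_2(G)\ \ge\ \delta(G). \] Write $K_{n_1,\dots,n_r}$ for the complete $r$-partite graph with class sizes $n_1,\dots,n_r$ ($r\ge 1$; for $r=1$ it is the edgeless graph). Equality $q_2(G)=\delta(G)$ holds if and only if $G$ is one of the following graphs: (i) a star; (ii) a regular complete multipartite graph $K_{t,\dots,t}$ (including the edgeless graph); (iii) the graph $K_{1,3,3}$; (iv) a complete multipartite graph $K_{1,\dots,1,2,\dots,2}$, all of whose classes have size $1$ or $2$; (v) the degenerate graph with exactly one edge, that is, $K_2$ together with $n-2$ isolated vertices. -/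

import Mathlib

namespace SimpleGraph

section Spectrum

variable {V : Type*} [Fintype V] [DecidableEq V] (G : SimpleGraph V) [DecidableRel G.Adj]

/-- The signless Laplacian `Q(G) = A + D` of a finite graph, as a real matrix. -/
def signlessLapMatrix : Matrix V V ℝ := G.adjMatrix ℝ + G.degMatrix ℝ

theorem isHermitian_signlessLapMatrix : G.signlessLapMatrix.IsHermitian :=
  (G.isHermitian_adjMatrix (R := ℝ)).add (G.isHermitian_degMatrix (R := ℝ))

/-- The eigenvalues of `Q(G)`, with multiplicity and in non-increasing order, indexed from `0`:
`G.signlessLapEigenvalue ⟨k, _⟩` is the `(k + 1)`-st largest one. -/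
noncomputable def signlessLapEigenvalue : Fin (Fintype.card V) → ℝ :=
  G.isHermitian_signlessLapMatrix.eigenvalues₀

end Spectrum

/-- A graph that is not complete has at least two vertices. -/
theorem one_lt_card_of_ne_top {V : Type*} [Fintype V] {G : SimpleGraph V} (hG : G ≠ ⊤) :
    1 < Fintype.card V := by
  by_contra h
  haveI : Subsingleton V := Fintype.card_le_one_iff_subsingleton.mp (not_lt.mp h)
  exact hG (Subsingleton.elim _ _)

/-- `q₂(G)`, the second largest eigenvalue of `Q(G)`, for a graph that is not complete
(hence has at least two vertices). -/
noncomputable def signlessLapSecond {V : Type*} [Fintype V] [DecidableEq V] (G : SimpleGraph V)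
    [DecidableRel G.Adj] (hG : G ≠ ⊤) : ℝ :=
  G.signlessLapEigenvalue ⟨1, one_lt_card_of_ne_top hG⟩

/-- The complete `r`-partite graph `K_{n₁,…,n_r}` with classes of sizes `n 0, …, n (r - 1)`. -/
abbrev completeMultipartiteOfSizes {r : ℕ} (n : Fin r → ℕ) : SimpleGraph (Σ i, Fin (n i)) :=
  completeMultipartiteGraph fun i => Fin (n i)

end SimpleGraph

/-! Everything is read off the quadratic form of `Q(G) - d I`. If `q₂ ≤ d`, no plane carries a
positive definite restriction (`mul_shiftedForm_le_sq`); conversely, a form nonpositive on a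
hyperplane gives `q₂ ≤ d` (`signlessLapSecond_le_of_forall_ker`). On two nonadjacent coordinate
vectors the form is diagonal with entries `deg - d`, which gives the lower bound at `d = δ`.

For equality with `δ = d > 0`, test vectors force `G` to be complete multipartite. A vertex of
degree above `d` is then dominating, since nonadjacent vertices share a class and hence a degree. If
`n ≤ d + 2`, classes have size 1 or 2. Otherwise two dominating vertices would violate
`not_adj_of_add_two_le_degree`, so `G` is regular or has a single dominating vertex. In the latter
case `d = 1` gives a star, and for `d > 1` `mul_le_of_dominating` together with a count of two
disjoint classes leaves only `K_{1,3,3}`. When `d = 0` the same local tests leave at most one edge.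

For the converse, each family has an explicit hyperplane, found from the expansion
`shiftedForm_self_of_fiber` in the multipartite cases. -/

namespace Matrix.IsHermitian

/-! ### Variational bounds for the second eigenvalue -/

variable {V : Type*} [Fintype V] [DecidableEq V] {A : Matrix V V ℝ}

/-- The index of the eigenbasis which belongs to the `k`-th largest eigenvalue. -/
noncomputable def indexEquiv (V : Type*) [Fintype V] : Fin (Fintype.card V) ≃ V :=
  Fintype.equivOfCardEq (Fintype.card_fin _)

theorem eigenvalues_indexEquiv (hA : A.IsHermitian) (k : Fin (Fintype.card V)) :
    hA.eigenvalues (indexEquiv V k) = hA.eigenvalues₀ k := by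
  simp [eigenvalues, indexEquiv]

theorem eigenvalues_le_of_one_le (hA : A.IsHermitian) (h1 : 1 < Fintype.card V) (i : V)
    (hi : i ≠ indexEquiv V ⟨0, h1.trans' one_pos⟩) :
    hA.eigenvalues i ≤ hA.eigenvalues₀ ⟨1, h1⟩ := by
  obtain ⟨k, rfl⟩ := (indexEquiv V).surjective i
  rw [eigenvalues_indexEquiv]
  apply hA.eigenvalues₀_antitone
  have : k ≠ ⟨0, h1.trans' one_pos⟩ := fun h => hi (by rw [h])
  rw [Fin.le_def]
  have h2 : k.val ≠ 0 := fun h => this (Fin.ext h)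
  simp only
  omega

theorem dotProduct_self_eq_sum_sq (hA : A.IsHermitian) (x : V → ℝ) :
    x ⬝ᵥ x = ∑ i, (⇑(hA.eigenvectorBasis i) ⬝ᵥ x) ^ 2 := by
  have h := hA.eigenvectorBasis.sum_inner_mul_inner (WithLp.toLp 2 x) (WithLp.toLp 2 x)
  simp only [EuclideanSpace.inner_eq_star_dotProduct, star_trivial] at h
  rw [← h]
  refine Finset.sum_congr rfl fun i _ => ?_
  rw [dotProduct_comm x, sq]

theorem dotProduct_mulVec_eq_sum (hA : A.IsHermitian) (x : V → ℝ) :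
    x ⬝ᵥ A *ᵥ x = ∑ i, hA.eigenvalues i * (⇑(hA.eigenvectorBasis i) ⬝ᵥ x) ^ 2 := by
  have h := hA.eigenvectorBasis.sum_inner_mul_inner (WithLp.toLp 2 x) (WithLp.toLp 2 (A *ᵥ x))
  simp only [EuclideanSpace.inner_eq_star_dotProduct, star_trivial] at h
  rw [dotProduct_comm, ← h]
  refine Finset.sum_congr rfl fun i _ => ?_
  have hT : Aᵀ = A := by simpa using hA.eq
  have h2 : (A *ᵥ x) ⬝ᵥ ⇑(hA.eigenvectorBasis i)
      = hA.eigenvalues i * (⇑(hA.eigenvectorBasis i) ⬝ᵥ x) := by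
    rw [dotProduct_comm, dotProduct_mulVec, ← mulVec_transpose, hT, hA.mulVec_eigenvectorBasis,
      smul_dotProduct, smul_eq_mul]
  rw [h2]
  ring

theorem exists_ne_zero_and_combination_eq_zero (a b : ℝ) :
    ∃ p r : ℝ, (p ≠ 0 ∨ r ≠ 0) ∧ p * a + r * b = 0 := by
  by_cases ha : a = 0
  · exact ⟨1, 0, by simp, by simp [ha]⟩
  · exact ⟨b, -a, by simp [ha], by ring⟩

/-- Some nontrivial combination of two vectors has a Rayleigh quotient that is at most the
second largest eigenvalue. -/
theorem exists_combination_le_second (hA : A.IsHermitian) (h1 : 1 < Fintype.card V)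
    (x y : V → ℝ) : ∃ p r : ℝ, (p ≠ 0 ∨ r ≠ 0) ∧
      (p • x + r • y) ⬝ᵥ A *ᵥ (p • x + r • y) ≤
        hA.eigenvalues₀ ⟨1, h1⟩ * ((p • x + r • y) ⬝ᵥ (p • x + r • y)) := by
  set i₀ := indexEquiv V ⟨0, h1.trans' one_pos⟩ with hi₀
  -- Choose the combination orthogonal to the top eigenvector, so only the remaining eigenvalues
  -- contribute.
  obtain ⟨p, r, hpr, h0⟩ := exists_ne_zero_and_combination_eq_zero
    (⇑(hA.eigenvectorBasis i₀) ⬝ᵥ x) (⇑(hA.eigenvectorBasis i₀) ⬝ᵥ y)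
  refine ⟨p, r, hpr, ?_⟩
  rw [hA.dotProduct_mulVec_eq_sum, hA.dotProduct_self_eq_sum_sq, Finset.mul_sum]
  refine Finset.sum_le_sum fun i _ => ?_
  by_cases hi : i = i₀
  · rw [hi, dotProduct_add, dotProduct_smul, dotProduct_smul, smul_eq_mul, smul_eq_mul, h0]
    simp
  · exact mul_le_mul_of_nonneg_right (hA.eigenvalues_le_of_one_le h1 i hi) (sq_nonneg _)

/-- If a quadratic form is bounded by `μ` on the kernel of a linear functional, then the second
largest eigenvalue is at most `μ`. -/
theorem second_le_of_forall_ker (hA : A.IsHermitian) (h1 : 1 < Fintype.card V) {μ : ℝ}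
    (f : (V → ℝ) →ₗ[ℝ] ℝ) (h : ∀ x, f x = 0 → x ⬝ᵥ A *ᵥ x ≤ μ * (x ⬝ᵥ x)) :
    hA.eigenvalues₀ ⟨1, h1⟩ ≤ μ := by
  set i₀ := indexEquiv V ⟨0, h1.trans' one_pos⟩ with hi₀
  set i₁ := indexEquiv V ⟨1, h1⟩ with hi₁
  have hne : i₀ ≠ i₁ := by simp [hi₀, hi₁]
  set u : V → ℝ := ⇑(hA.eigenvectorBasis i₀)
  set v : V → ℝ := ⇑(hA.eigenvectorBasis i₁)
  have hdot : ∀ i j, ⇑(hA.eigenvectorBasis i) ⬝ᵥ ⇑(hA.eigenvectorBasis j)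
      = if i = j then (1 : ℝ) else 0 := by
    intro i j
    have := hA.eigenvectorBasis.inner_eq_ite j i
    simp only [EuclideanSpace.inner_eq_star_dotProduct, star_trivial] at this
    rw [this]
    simp [eq_comm]
  have huu : u ⬝ᵥ u = 1 := by simp [u, hdot]
  have hvv : v ⬝ᵥ v = 1 := by simp [v, hdot]
  have huv : u ⬝ᵥ v = 0 := by simp [u, v, hdot, hne]
  have hvu : v ⬝ᵥ u = 0 := by simp [u, v, hdot, hne.symm]
  have hAu : A *ᵥ u = hA.eigenvalues₀ ⟨0, h1.trans' one_pos⟩ • u := by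
    rw [hA.mulVec_eigenvectorBasis, eigenvalues_indexEquiv]
  have hAv : A *ᵥ v = hA.eigenvalues₀ ⟨1, h1⟩ • v := by
    rw [hA.mulVec_eigenvectorBasis, eigenvalues_indexEquiv]
  have hle : hA.eigenvalues₀ ⟨1, h1⟩ ≤ hA.eigenvalues₀ ⟨0, h1.trans' one_pos⟩ :=
    hA.eigenvalues₀_antitone (by simp [Fin.le_def])
  -- The kernel meets the plane of the top two eigenvectors, on which the Rayleigh quotient is at
  -- least the second eigenvalue.
  obtain ⟨p, r, hpr, h0⟩ := exists_ne_zero_and_combination_eq_zero (f u) (f v)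
  have key := h (p • u + r • v) (by simpa using h0)
  simp only [mulVec_add, mulVec_smul, hAu, hAv, dotProduct_add, add_dotProduct, dotProduct_smul,
    smul_dotProduct, huu, hvv, huv, hvu, smul_eq_mul] at key
  have hpos : 0 < p ^ 2 + r ^ 2 := by
    rcases hpr with hp | hr
    · have := pow_pos (abs_pos.mpr hp) 2
      rw [sq_abs] at this
      nlinarith [sq_nonneg r]
    · have := pow_pos (abs_pos.mpr hr) 2
      rw [sq_abs] at this
      nlinarith [sq_nonneg p]
  by_contra hcon
  push Not at hcon
  nlinarith [mul_le_mul_of_nonneg_left hle (sq_nonneg p), mul_lt_mul_of_pos_right hcon hpos]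

end Matrix.IsHermitian

namespace SimpleGraph

open Finset Matrix

/-! ### The form of `Q(G) - d I` and the lower bound -/

section Form

variable {V : Type*} [Fintype V] [DecidableEq V] (G : SimpleGraph V) [DecidableRel G.Adj]

/-- The bilinear form of `Q(G) - d I`. -/
noncomputable def shiftedForm (d : ℝ) (x y : V → ℝ) : ℝ :=
  x ⬝ᵥ G.signlessLapMatrix *ᵥ y - d * (x ⬝ᵥ y)

theorem shiftedForm_add_left (d : ℝ) (x y z : V → ℝ) :
    G.shiftedForm d (x + y) z = G.shiftedForm d x z + G.shiftedForm d y z := by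
  simp only [shiftedForm, add_dotProduct]
  ring

theorem shiftedForm_add_right (d : ℝ) (x y z : V → ℝ) :
    G.shiftedForm d x (y + z) = G.shiftedForm d x y + G.shiftedForm d x z := by
  simp only [shiftedForm, mulVec_add, dotProduct_add]
  ring

theorem shiftedForm_smul_left (d p : ℝ) (x y : V → ℝ) :
    G.shiftedForm d (p • x) y = p * G.shiftedForm d x y := by
  simp only [shiftedForm, smul_dotProduct, smul_eq_mul]
  ring

theorem shiftedForm_smul_right (d p : ℝ) (x y : V → ℝ) :
    G.shiftedForm d x (p • y) = p * G.shiftedForm d x y := by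
  simp only [shiftedForm, mulVec_smul, dotProduct_smul, smul_eq_mul]
  ring

theorem shiftedForm_comm (d : ℝ) (x y : V → ℝ) :
    G.shiftedForm d x y = G.shiftedForm d y x := by
  have hT : G.signlessLapMatrixᵀ = G.signlessLapMatrix := by
    simpa using G.isHermitian_signlessLapMatrix.eq
  rw [shiftedForm, shiftedForm, dotProduct_comm x y, dotProduct_mulVec, ← mulVec_transpose, hT,
    dotProduct_comm]

theorem shiftedForm_eq_sum (d : ℝ) (x y : V → ℝ) :
    G.shiftedForm d x y = (∑ u, ∑ v, if G.Adj u v then x u * y v else 0)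
      + ∑ u, (G.degree u - d) * (x u * y u) := by
  have h1 : x ⬝ᵥ G.degMatrix ℝ *ᵥ y = ∑ u, (G.degree u : ℝ) * (x u * y u) := by
    simp only [dotProduct, degMatrix_mulVec_apply]
    exact Finset.sum_congr rfl fun u _ => by ring
  have h2 : x ⬝ᵥ G.adjMatrix ℝ *ᵥ y = ∑ u, ∑ v, if G.Adj u v then x u * y v else 0 := by
    simp only [dotProduct, mulVec, adjMatrix_apply, Finset.mul_sum]
    refine Finset.sum_congr rfl fun u _ => Finset.sum_congr rfl fun v _ => ?_
    split_ifs <;> simp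
  rw [shiftedForm, signlessLapMatrix, add_mulVec, dotProduct_add, h1, h2]
  simp only [sub_mul, Finset.sum_sub_distrib, dotProduct, Finset.mul_sum]
  ring

theorem shiftedForm_single_self (d : ℝ) (u : V) :
    G.shiftedForm d (Pi.single u 1) (Pi.single u 1) = G.degree u - d := by
  simp [shiftedForm, signlessLapMatrix, degMatrix, adjMatrix_apply]

theorem shiftedForm_single_of_adj (d : ℝ) {u v : V} (h : G.Adj u v) :
    G.shiftedForm d (Pi.single u 1) (Pi.single v 1) = 1 := by
  simp [shiftedForm, signlessLapMatrix, degMatrix, adjMatrix_apply, h, h.ne]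

theorem shiftedForm_single_of_not_adj (d : ℝ) {u v : V} (hne : u ≠ v) (h : ¬ G.Adj u v) :
    G.shiftedForm d (Pi.single u 1) (Pi.single v 1) = 0 := by
  simp [shiftedForm, signlessLapMatrix, degMatrix, adjMatrix_apply, h, hne]

theorem shiftedForm_single_one (d : ℝ) (u : V) :
    G.shiftedForm d (Pi.single u 1) 1 = 2 * G.degree u - d := by
  have h : (G.adjMatrix ℝ *ᵥ 1) u = G.degree u := by
    simp
  simp [shiftedForm, signlessLapMatrix, add_mulVec, h, degMatrix_mulVec_apply]
  ring

theorem shiftedForm_one_one (d : ℝ) :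
    G.shiftedForm d 1 1 = ∑ u, (2 * G.degree u - d) := by
  have h : (1 : V → ℝ) = ∑ u, Pi.single u 1 := by
    ext v
    simp [Finset.sum_apply, Pi.single_apply]
  have h2 : ∀ s : Finset V, G.shiftedForm d (∑ u ∈ s, Pi.single u 1) 1
      = ∑ u ∈ s, (2 * (G.degree u : ℝ) - d) := by
    intro s
    induction s using Finset.induction_on with
    | empty => simp [shiftedForm]
    | insert a s ha ih =>
      rw [Finset.sum_insert ha, Finset.sum_insert ha, shiftedForm_add_left, ih,
        shiftedForm_single_one]
  conv_lhs => rw [h]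
  rw [← h2, ← h]

theorem exists_shiftedForm_combination_le (hG : G ≠ ⊤) (d : ℝ) (x y : V → ℝ) :
    ∃ p r : ℝ, (p ≠ 0 ∨ r ≠ 0) ∧
      p ^ 2 * G.shiftedForm d x x + 2 * (p * r) * G.shiftedForm d x y
        + r ^ 2 * G.shiftedForm d y y
        ≤ (G.signlessLapSecond hG - d) * ((p • x + r • y) ⬝ᵥ (p • x + r • y)) := by
  obtain ⟨p, r, hpr, h⟩ := G.isHermitian_signlessLapMatrix.exists_combination_le_second
    (one_lt_card_of_ne_top hG) x y
  refine ⟨p, r, hpr, ?_⟩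
  have h2 : G.shiftedForm d (p • x + r • y) (p • x + r • y)
      ≤ (G.signlessLapSecond hG - d) * ((p • x + r • y) ⬝ᵥ (p • x + r • y)) := by
    rw [sub_mul]
    exact sub_le_sub_right h _
  refine le_trans (le_of_eq ?_) h2
  simp only [shiftedForm_add_left, shiftedForm_add_right, shiftedForm_smul_left,
    shiftedForm_smul_right, G.shiftedForm_comm d y x]
  ring

/-- If `q₂(G) ≤ d`, then `Q(G) - d I` has no positive definite two-dimensional section. -/
theorem mul_shiftedForm_le_sq {hG : G ≠ ⊤} {d : ℝ} (h : G.signlessLapSecond hG ≤ d)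
    (x y : V → ℝ) (hx : 0 < G.shiftedForm d x x) :
    G.shiftedForm d x x * G.shiftedForm d y y ≤ G.shiftedForm d x y ^ 2 := by
  obtain ⟨p, r, hpr, hle⟩ := G.exists_shiftedForm_combination_le hG d x y
  set a := G.shiftedForm d x x
  set b := G.shiftedForm d x y
  set c := G.shiftedForm d y y
  have h0 : p ^ 2 * a + 2 * (p * r) * b + r ^ 2 * c ≤ 0 :=
    hle.trans (mul_nonpos_of_nonpos_of_nonneg (by linarith)
      (by simpa using dotProduct_star_self_nonneg (p • x + r • y)))
  by_contra! hcon
  -- Completing the square: a positive determinant forces `r = 0`, and then `a > 0` forces `p = 0`.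
  have h1 : a * (p ^ 2 * a + 2 * (p * r) * b + r ^ 2 * c)
      = (p * a + r * b) ^ 2 + r ^ 2 * (a * c - b ^ 2) := by ring
  have h2 : (p * a + r * b) ^ 2 + r ^ 2 * (a * c - b ^ 2) ≤ 0 := by
    rw [← h1]
    exact mul_nonpos_of_nonneg_of_nonpos hx.le h0
  have h3 : r ^ 2 * (a * c - b ^ 2) ≤ 0 := by nlinarith [sq_nonneg (p * a + r * b)]
  have hr : r = 0 := by
    by_contra hr
    have := mul_pos (pow_pos (abs_pos.mpr hr) 2) (sub_pos.mpr hcon)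
    rw [sq_abs] at this
    linarith
  subst hr
  have hp : p ≠ 0 := by simpa using hpr
  have hp2 : 0 < p ^ 2 := by positivity
  nlinarith [mul_pos hp2 hx]

theorem min_degree_le_signlessLapSecond (hG : G ≠ ⊤) {u v : V} (hne : u ≠ v)
    (h : ¬ G.Adj u v) {d : ℝ} (hu : d ≤ G.degree u) (hv : d ≤ G.degree v) :
    d ≤ G.signlessLapSecond hG := by
  obtain ⟨p, r, hpr, hle⟩ := G.exists_shiftedForm_combination_le hG d
    (Pi.single u 1) (Pi.single v 1)
  rw [shiftedForm_single_self, shiftedForm_single_self, G.shiftedForm_single_of_not_adj d hne h]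
    at hle
  have hdot : (p • (Pi.single u 1 : V → ℝ) + r • Pi.single v 1) ⬝ᵥ
      (p • (Pi.single u 1 : V → ℝ) + r • Pi.single v 1) = p ^ 2 + r ^ 2 := by
    simp only [add_dotProduct, dotProduct_add, smul_dotProduct, dotProduct_smul,
      single_dotProduct, Pi.single_eq_same, Pi.single_eq_of_ne hne, Pi.single_eq_of_ne hne.symm,
      smul_eq_mul]
    ring
  rw [hdot] at hle
  have hpos : 0 < p ^ 2 + r ^ 2 := by
    rcases hpr with hp | hr <;> positivity
  by_contra! hcon
  nlinarith [mul_nonneg (sq_nonneg p) (sub_nonneg.mpr hu),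
    mul_nonneg (sq_nonneg r) (sub_nonneg.mpr hv), mul_pos hpos (sub_pos.mpr hcon)]

theorem minDegree_le_signlessLapSecond (hG : G ≠ ⊤) :
    (G.minDegree : ℝ) ≤ G.signlessLapSecond hG := by
  obtain ⟨u, v, hne, h⟩ := ne_top_iff_exists_not_adj.mp hG
  exact G.min_degree_le_signlessLapSecond hG hne h
    (by exact_mod_cast G.minDegree_le_degree u) (by exact_mod_cast G.minDegree_le_degree v)

/-- If the form of `Q(G) - d I` is nonpositive on the kernel of a linear functional, then
`q₂(G) ≤ d`. -/
theorem signlessLapSecond_le_of_forall_ker (hG : G ≠ ⊤) {d : ℝ} (f : (V → ℝ) →ₗ[ℝ] ℝ)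
    (h : ∀ x, f x = 0 → G.shiftedForm d x x ≤ 0) : G.signlessLapSecond hG ≤ d :=
  G.isHermitian_signlessLapMatrix.second_le_of_forall_ker (one_lt_card_of_ne_top hG) f
    fun x hx => sub_nonpos.mp (h x hx)

end Form

/-! ### Local consequences of `q₂ ≤ d` -/

section SmallSecond

variable {V : Type*} [Fintype V] [DecidableEq V] {G : SimpleGraph V} [DecidableRel G.Adj]
  {hG : G ≠ ⊤} {d : ℕ}

theorem degree_le_of_not_adj (h : G.signlessLapSecond hG ≤ d) {u v : V} (hne : u ≠ v)
    (huv : ¬ G.Adj u v) (hu : d < G.degree u) : G.degree v ≤ d := by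
  by_contra! hv
  have hu' : (0 : ℝ) < G.degree u - d := sub_pos.mpr (by exact_mod_cast hu)
  have hv' : (0 : ℝ) < G.degree v - d := sub_pos.mpr (by exact_mod_cast hv)
  have := G.mul_shiftedForm_le_sq h (Pi.single u 1) (Pi.single v 1)
    (by rwa [shiftedForm_single_self])
  rw [shiftedForm_single_self, shiftedForm_single_self, G.shiftedForm_single_of_not_adj _ hne huv]
    at this
  nlinarith [mul_pos hu' hv']

/-- For adjacent vertices the Gram matrix would have diagonal at least 2 and off-diagonal 1, hence
be positive definite. -/
theorem not_adj_of_add_two_le_degree (h : G.signlessLapSecond hG ≤ d) {u v : V}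
    (hu : d + 2 ≤ G.degree u) (hv : d + 2 ≤ G.degree v) : ¬ G.Adj u v := by
  intro huv
  have hu' : (d : ℝ) + 2 ≤ G.degree u := by exact_mod_cast hu
  have hv' : (d : ℝ) + 2 ≤ G.degree v := by exact_mod_cast hv
  have := G.mul_shiftedForm_le_sq h (Pi.single u 1) (Pi.single v 1)
    (by rw [shiftedForm_single_self]; linarith)
  rw [shiftedForm_single_self, shiftedForm_single_self, G.shiftedForm_single_of_adj _ huv] at this
  nlinarith

/-- Otherwise some `w` misses both ends of an edge `uv`; as `d > 0`, it has a neighbour `z`. The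
vectors `e_u + e_v` and `2 e_w + e_z` have squares at least 2 and 4 and a product between 0 and 2,
so the determinant is at least `8 - 4 > 0`. The weight 2 on `w` is what makes this strict. -/
theorem isCompleteMultipartite_of_second_le (h : G.signlessLapSecond hG ≤ d) (hd : 0 < d)
    (hmin : ∀ v, d ≤ G.degree v) : G.IsCompleteMultipartite := by
  by_contra hcon
  obtain ⟨w, u, v, huv, hwu, hwv⟩ := exists_isPathGraph3Compl_of_not_isCompleteMultipartite hcon
  have hwu' : w ≠ u := fun e => hwv (e ▸ huv)
  have hwv' : w ≠ v := fun e => hwu (e ▸ huv.symm)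
  obtain ⟨z, hwz⟩ : ∃ z, G.Adj w z := by
    rw [← G.degree_pos_iff_exists_adj]
    exact hd.trans_le (hmin w)
  have hzu : u ≠ z := fun e => hwu (e ▸ hwz)
  have hzv : v ≠ z := fun e => hwv (e ▸ hwz)
  have hc : ∀ a, (0 : ℝ) ≤ G.degree a - d := fun a => sub_nonneg.mpr (by exact_mod_cast hmin a)
  have hz : ∀ a, a ≠ z → 0 ≤ G.shiftedForm d (Pi.single a 1) (Pi.single z 1) ∧
      G.shiftedForm d (Pi.single a 1) (Pi.single z 1) ≤ 1 := by
    intro a ha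
    by_cases hadj : G.Adj a z
    · simp [G.shiftedForm_single_of_adj _ hadj]
    · simp [G.shiftedForm_single_of_not_adj _ ha hadj]
  have hxx : G.shiftedForm d (Pi.single u 1 + Pi.single v 1) (Pi.single u 1 + Pi.single v 1)
      = (G.degree u - d) + (G.degree v - d) + 2 := by
    simp only [shiftedForm_add_left, shiftedForm_add_right, shiftedForm_single_self,
      G.shiftedForm_single_of_adj _ huv, G.shiftedForm_single_of_adj _ huv.symm]
    ring
  have hyy : G.shiftedForm d ((2 : ℝ) • Pi.single w 1 + Pi.single z 1)
      ((2 : ℝ) • Pi.single w 1 + Pi.single z 1)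
      = 4 * (G.degree w - d) + (G.degree z - d) + 4 := by
    simp only [shiftedForm_add_left, shiftedForm_add_right, shiftedForm_smul_left,
      shiftedForm_smul_right, shiftedForm_single_self,
      G.shiftedForm_single_of_adj _ hwz, G.shiftedForm_single_of_adj _ hwz.symm]
    ring
  have hxy : G.shiftedForm d (Pi.single u 1 + Pi.single v 1)
      ((2 : ℝ) • Pi.single w 1 + Pi.single z 1)
      = G.shiftedForm d (Pi.single u 1) (Pi.single z 1)
        + G.shiftedForm d (Pi.single v 1) (Pi.single z 1) := by
    simp only [shiftedForm_add_left, shiftedForm_add_right,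
      shiftedForm_smul_right,
      G.shiftedForm_single_of_not_adj _ hwu'.symm (fun e => hwu e.symm),
      G.shiftedForm_single_of_not_adj _ hwv'.symm (fun e => hwv e.symm)]
    ring
  have := G.mul_shiftedForm_le_sq h (Pi.single u 1 + Pi.single v 1)
    ((2 : ℝ) • Pi.single w 1 + Pi.single z 1) (by rw [hxx]; linarith [hc u, hc v])
  rw [hxx, hyy, hxy] at this
  have h1 := hz u hzu
  have h2 := hz v hzv
  have h3 : (8 : ℝ) ≤ (G.degree u - d + (G.degree v - d) + 2) *
      (4 * (G.degree w - d) + (G.degree z - d) + 4) := by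
    calc (8 : ℝ) = 2 * 4 := by norm_num
      _ ≤ _ := mul_le_mul (by linarith [hc u, hc v]) (by linarith [hc w, hc z]) (by norm_num)
        (by linarith [hc u, hc v])
  nlinarith

/-- The trade-off between order and minimum degree which a unique dominating vertex forces. -/
theorem mul_le_of_dominating (h : G.signlessLapSecond hG ≤ d) {c : V} {N : ℕ}
    (hn : Fintype.card V = N + 1) (hN : d < N) (hc : G.degree c = N)
    (hdeg : ∀ v, v ≠ c → G.degree v = d) : ((N : ℝ) - d) * (d - 1) ≤ N := by
  have hN' : (0 : ℝ) < N - d := sub_pos.mpr (by exact_mod_cast hN)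
  have hN0 : (0 : ℝ) < N := by exact_mod_cast (Nat.zero_le d).trans_lt hN
  have h11 : G.shiftedForm d 1 1 = 2 * N - d + N * d := by
    rw [shiftedForm_one_one, ← Finset.add_sum_erase _ _ (mem_univ c), hc,
      Finset.sum_congr rfl (g := fun _ => (d : ℝ)), Finset.sum_const, card_erase_of_mem (mem_univ c),
      card_univ, hn]
    · simp
    · intro u hu
      rw [hdeg u (ne_of_mem_erase hu)]
      ring
  -- Against the indicator of the other vertices, the Gram entries are `N - d`, `N` and `N (d - 1)`.
  have := G.mul_shiftedForm_le_sq h (Pi.single c 1) (1 + (-1 : ℝ) • Pi.single c 1)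
    (by rwa [shiftedForm_single_self, hc])
  simp only [shiftedForm_add_left, shiftedForm_add_right, shiftedForm_smul_left,
    shiftedForm_smul_right, shiftedForm_single_self, shiftedForm_single_one, h11,
    G.shiftedForm_comm d 1 (Pi.single c 1), hc] at this
  have h2 : N * (((N : ℝ) - d) * (d - 1)) ≤ N * N := by nlinarith
  exact le_of_mul_le_mul_left h2 hN0

end SmallSecond

/-! ### Recognising complete multipartite graphs from their degrees -/

section Classes

variable {V : Type*} [Fintype V] {G : SimpleGraph V}

theorem degree_add_card_not_adj (G : SimpleGraph V) [DecidableRel G.Adj] (v : V) :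
    G.degree v + #{w | ¬ G.Adj v w} = Fintype.card V := by
  rw [← card_neighborFinset_eq_degree, neighborFinset_eq_filter,
    card_filter_add_card_filter_not, card_univ]

theorem card_fiber_eq_card_not_adj [DecidableRel G.Adj] {ι : Type*} [DecidableEq ι]
    {f : V → ι} (hf : ∀ a b, G.Adj a b ↔ f a ≠ f b) (v : V) :
    #{w | f w = f v} = #{w | ¬ G.Adj v w} := by
  congr 1
  ext w
  simp [hf, eq_comm]

theorem degree_add_card_fiber [DecidableRel G.Adj] {ι : Type*} [DecidableEq ι] {f : V → ι}
    (hf : ∀ a b, G.Adj a b ↔ f a ≠ f b) (v : V) :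
    G.degree v + #{w | f w = f v} = Fintype.card V := by
  rw [card_fiber_eq_card_not_adj hf, degree_add_card_not_adj]

theorem nonempty_iso_completeMultipartiteOfSizes {r : ℕ} {f : V → Fin r} {n : Fin r → ℕ}
    (hf : ∀ a b, G.Adj a b ↔ f a ≠ f b) (hn : ∀ i, #{v | f v = i} = n i) :
    Nonempty (G ≃g completeMultipartiteOfSizes n) := by
  have e : ∀ i, {v // f v = i} ≃ Fin (n i) := fun i =>
    Fintype.equivFinOfCardEq (by rw [Fintype.card_subtype, hn])
  refine ⟨⟨(Equiv.sigmaFiberEquiv f).symm.trans (Equiv.sigmaCongrRight e), ?_⟩⟩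
  intro a b
  simp [hf]

theorem exists_fiber_of_iso {r : ℕ} {n : Fin r → ℕ} (e : G ≃g completeMultipartiteOfSizes n) :
    ∃ f : V → Fin r, (∀ a b, G.Adj a b ↔ f a ≠ f b) ∧ ∀ i, #{v | f v = i} = n i := by
  refine ⟨fun v => (e v).1, fun a b => ?_, fun i => ?_⟩
  · rw [← e.map_adj_iff]
    simp
  · rw [← Fintype.card_subtype]
    have h1 : {v // (e v).1 = i} ≃ {s : Σ i, Fin (n i) // s.1 = i} :=
      e.toEquiv.subtypeEquiv fun v => Iff.rfl
    rw [Fintype.card_congr (h1.trans (Equiv.sigmaSubtype i)), Fintype.card_fin]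

theorem IsCompleteMultipartite.exists_fin_fiber (h : G.IsCompleteMultipartite) :
    ∃ (r : ℕ) (f : V → Fin r), f.Surjective ∧ ∀ a b, G.Adj a b ↔ f a ≠ f b := by
  classical
  have : DecidableRel h.setoid.r := Classical.decRel _
  let e := Fintype.equivFin (Quotient h.setoid)
  refine ⟨_, fun v => e (Quotient.mk _ v), e.surjective.comp Quotient.mk_surjective,
    fun a b => ?_⟩
  rw [Ne, e.apply_eq_iff_eq, Quotient.eq]
  exact (not_not (a := G.Adj a b)).symm

theorem exists_sizes_one_or_two [DecidableRel G.Adj] (h : G.IsCompleteMultipartite)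
    (hV : ∀ v, Fintype.card V ≤ G.degree v + 2) :
    ∃ (r : ℕ) (n : Fin r → ℕ), (∀ i, n i = 1 ∨ n i = 2) ∧
      Nonempty (G ≃g completeMultipartiteOfSizes n) := by
  obtain ⟨r, f, hsurj, hf⟩ := h.exists_fin_fiber
  refine ⟨r, fun i => #{v | f v = i}, fun i => ?_,
    nonempty_iso_completeMultipartiteOfSizes hf fun i => rfl⟩
  obtain ⟨v, rfl⟩ := hsurj i
  have h1 := degree_add_card_not_adj G v
  have h2 := hV v
  have h3 := G.degree_lt_card_verts v
  simp only [card_fiber_eq_card_not_adj hf v]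
  omega

theorem eq_starGraph_of_degree_eq_one [DecidableEq V] [DecidableRel G.Adj] {c : V}
    (hc : ∀ v, v ≠ c → G.Adj c v)
    (hdeg : ∀ v, v ≠ c → G.degree v = 1) : G = starGraph c := by
  have key : ∀ a b, a ≠ c → G.Adj a b → b = c := by
    intro a b ha hab
    obtain ⟨x, hx⟩ := Finset.card_eq_one.mp (hdeg a ha)
    have h1 : c ∈ G.neighborFinset a := (mem_neighborFinset _ _ _).mpr (hc a ha).symm
    have h2 : b ∈ G.neighborFinset a := (mem_neighborFinset _ _ _).mpr hab
    rw [hx, mem_singleton] at h1 h2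
    rw [h1, h2]
  ext a b
  rw [starGraph_adj]
  constructor
  · intro hab
    refine ⟨hab.ne, ?_⟩
    by_contra! hcon
    exact hcon.2 (key a b hcon.1 hab)
  · rintro ⟨hne, rfl | rfl⟩
    · exact hc b hne.symm
    · exact (hc a hne).symm

/-- Adjacent vertices lie in disjoint classes. -/
theorem IsCompleteMultipartite.disjoint_not_adj [DecidableRel G.Adj]
    (h : G.IsCompleteMultipartite) {y z : V} (hyz : G.Adj y z) :
    Disjoint ({w | ¬ G.Adj y w} : Finset V) ({w | ¬ G.Adj z w} : Finset V) := by
  rw [Finset.disjoint_left]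
  intro w hy hz
  simp only [mem_filter, mem_univ, true_and] at hy hz
  exact h.trans y w z hy (fun e => hz e.symm) hyz

theorem nonempty_iso_one_three_three [DecidableEq V] [DecidableRel G.Adj]
    (h : G.IsCompleteMultipartite) {c : V}
    (hn : Fintype.card V = 7) (hc : ∀ v, v ≠ c → G.Adj c v)
    (hdeg : ∀ v, v ≠ c → G.degree v = 4) :
    Nonempty (G ≃g completeMultipartiteOfSizes ![1, 3, 3]) := by
  have hcls : ∀ v, v ≠ c → #{w | ¬ G.Adj v w} = 3 := by
    intro v hv
    have h1 := degree_add_card_not_adj G v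
    rw [hdeg v hv] at h1
    omega
  obtain ⟨y, hy⟩ : ∃ y, y ≠ c := by
    have : Nontrivial V := Fintype.one_lt_card_iff_nontrivial.mp (by omega)
    exact exists_ne c
  obtain ⟨z, hz, hzc⟩ : ∃ z ∈ G.neighborFinset y, z ≠ c :=
    Finset.exists_mem_ne (by rw [card_neighborFinset_eq_degree, hdeg y hy]; norm_num) c
  rw [mem_neighborFinset] at hz
  have hdisj := h.disjoint_not_adj hz
  have hcY : c ∉ ({w | ¬ G.Adj y w} : Finset V) := by simpa using (hc y hy).symm
  have hcZ : c ∉ ({w | ¬ G.Adj z w} : Finset V) := by simpa using (hc z hzc).symm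
  -- Since `1 + 3 + 3 = 7`, the vertex `c` and the classes of `y` and `z` exhaust the graph.
  have hunion : insert c (({w | ¬ G.Adj y w} : Finset V) ∪ ({w | ¬ G.Adj z w} : Finset V))
      = univ := by
    rw [← card_eq_iff_eq_univ,
      card_insert_of_notMem (by rw [mem_union]; exact not_or.mpr ⟨hcY, hcZ⟩),
      card_union_of_disjoint hdisj, hcls y hy, hcls z hzc, hn]
  have hcover : ∀ w, w = c ∨ ¬ G.Adj y w ∨ ¬ G.Adj z w := by
    intro w
    have := mem_univ w
    rw [← hunion] at this
    simpa using this
  have hexcl : ∀ w, ¬ G.Adj y w → G.Adj z w := by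
    intro w h1
    have := Finset.disjoint_left.mp hdisj (show w ∈ _ by simpa using h1)
    simpa using this
  have htr : ∀ a b e, ¬ G.Adj a b → ¬ G.Adj b e → ¬ G.Adj a e := fun a b e => h.trans a b e
  refine nonempty_iso_completeMultipartiteOfSizes
    (f := fun w => if w = c then 0 else if G.Adj y w then 2 else 1) ?_ ?_
  · have hyc := (hc y hy)
    intro a b
    have := hcover a
    have := hcover b
    have := hexcl a
    have := hexcl b
    have := htr a y b
    have := htr a z b
    have := htr y a b
    have := htr y b a
    have := hc a
    have := hc b
    have := G.adj_comm
    have := G.irrefl (v := c)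
    grind
  · intro i
    fin_cases i
    · have : ({v | (if v = c then (0 : Fin 3) else if G.Adj y v then 2 else 1) = 0} : Finset V)
          = {c} := by
        ext w
        simp only [mem_filter, mem_univ, true_and, mem_singleton]
        split_ifs <;> simp_all
      exact (congrArg card this).trans (card_singleton c)
    · have : ({v | (if v = c then (0 : Fin 3) else if G.Adj y v then 2 else 1) = 1} : Finset V)
          = ({w | ¬ G.Adj y w} : Finset V) := by
        ext w
        simp only [mem_filter, mem_univ, true_and]
        have := (hc y hy).symm
        split_ifs <;> simp_all
      exact (congrArg card this).trans (hcls y hy)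
    · have : ({v | (if v = c then (0 : Fin 3) else if G.Adj y v then 2 else 1) = 2} : Finset V)
          = ({w | ¬ G.Adj z w} : Finset V) := by
        ext w
        simp only [mem_filter, mem_univ, true_and]
        have := (hc z hzc).symm
        have := hcover w
        have := hexcl w
        split_ifs <;> simp_all
      exact (congrArg card this).trans (hcls z hzc)

end Classes

/-! ### Equality forces membership in the list -/

section Forward

variable {V : Type*} [Fintype V] [DecidableEq V] {G : SimpleGraph V} [DecidableRel G.Adj]

/-- Vertices of positive degree are pairwise adjacent, so a third one would close a triangle on an
edge, whose ends would then both have degree at least 2. -/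
theorem eq_bot_or_card_edgeFinset_eq_one {hG : G ≠ ⊤} (h : G.signlessLapSecond hG ≤ (0 : ℕ)) :
    G = ⊥ ∨ #G.edgeFinset = 1 := by
  by_cases hb : G = ⊥
  · exact Or.inl hb
  right
  obtain ⟨u, v, huv⟩ := ne_bot_iff_exists_adj.mp hb
  have hadj : ∀ a b, a ≠ b → 0 < G.degree a → 0 < G.degree b → G.Adj a b := by
    intro a b hne ha hb
    by_contra hab
    have := degree_le_of_not_adj h hne hab ha
    omega
  have hpos : ∀ {a b}, G.Adj a b → 0 < G.degree a := fun {a b} hab =>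
    (G.degree_pos_iff_exists_adj a).mpr ⟨b, hab⟩
  have hmem : ∀ w, 0 < G.degree w → w = u ∨ w = v := by
    intro w hw
    by_contra! hcon
    have hwu := hadj w u hcon.1 hw (hpos huv)
    have hwv := hadj w v hcon.2 hw (hpos huv.symm)
    have h2 : ∀ a b e, G.Adj a b → G.Adj a e → b ≠ e → 2 ≤ G.degree a := by
      intro a b e hab hae hbe
      rw [← card_neighborFinset_eq_degree, ← card_pair hbe]
      exact card_le_card (by simp [insert_subset_iff, hab, hae])
    exact not_adj_of_add_two_le_degree h (by simpa using h2 u v w huv hwu.symm hcon.2.symm)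
      (by simpa using h2 v u w huv.symm hwv.symm hcon.1.symm) huv
  refine card_eq_one.mpr ⟨s(u, v), ?_⟩
  ext e
  induction e with
  | _ a b =>
    rw [mem_edgeFinset, mem_edgeSet, mem_singleton, Sym2.eq_iff]
    constructor
    · intro hab
      have := hmem a (hpos hab)
      have := hmem b (hpos hab.symm)
      have := hab.ne
      grind
    · rintro (⟨rfl, rfl⟩ | ⟨rfl, rfl⟩)
      · exact huv
      · exact huv.symm

theorem classification_of_second_le_of_pos {hG : G ≠ ⊤} {d : ℕ}
    (h : G.signlessLapSecond hG ≤ d) (hd : 0 < d) (hmin : ∀ v, d ≤ G.degree v) :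
    (∃ c : V, G = starGraph c) ∨ (G.IsCompleteMultipartite ∧ ∃ d : ℕ, G.IsRegularOfDegree d) ∨
      Nonempty (G ≃g completeMultipartiteOfSizes ![1, 3, 3]) ∨
      ∃ (r : ℕ) (n : Fin r → ℕ), (∀ i, n i = 1 ∨ n i = 2) ∧
        Nonempty (G ≃g completeMultipartiteOfSizes n) := by
  have hM := isCompleteMultipartite_of_second_le h hd hmin
  obtain ⟨N, hN⟩ : ∃ N, Fintype.card V = N + 1 :=
    ⟨Fintype.card V - 1, by have := one_lt_card_of_ne_top hG; omega⟩
  have hdom : ∀ c, d < G.degree c → ∀ v, v ≠ c → G.Adj c v := by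
    intro c hc v hv
    by_contra hcv
    have h1 := degree_le_of_not_adj h hv.symm hcv hc
    have h2 : ({w | ¬ G.Adj c w} : Finset V) = ({w | ¬ G.Adj v w} : Finset V) := by
      ext w
      simp only [mem_filter, mem_univ, true_and]
      exact ⟨hM.trans v c w fun e => hcv e.symm, hM.trans c v w hcv⟩
    have h3 := degree_add_card_not_adj G c
    have h4 := degree_add_card_not_adj G v
    rw [h2] at h3
    omega
  have hdomdeg : ∀ c, d < G.degree c → G.degree c = N := by
    intro c hc
    have h2 : G.neighborFinset c = univ.erase c := by
      ext w
      simp only [mem_neighborFinset, mem_erase, mem_univ, and_true]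
      exact ⟨fun e => e.ne', hdom c hc w⟩
    rw [← card_neighborFinset_eq_degree, h2, card_erase_of_mem (mem_univ c), card_univ, hN]
    rfl
  by_cases hm : Fintype.card V ≤ d + 2
  · exact Or.inr (Or.inr (Or.inr (exists_sizes_one_or_two hM fun v => by
      have := hmin v
      omega)))
  by_cases hex : ∃ c, d < G.degree c
  swap
  · push Not at hex
    exact Or.inr (Or.inl ⟨hM, d, fun v => le_antisymm (hex v) (hmin v)⟩)
  obtain ⟨c, hc⟩ := hex
  have hcN := hdomdeg c hc
  have hrest : ∀ v, v ≠ c → G.degree v = d := by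
    intro v hv
    by_contra hne
    have h1 := hdomdeg v (lt_of_le_of_ne (hmin v) (Ne.symm hne))
    exact not_adj_of_add_two_le_degree h (by omega) (by omega) (hdom c hc v hv)
  by_cases hd1 : d = 1
  · exact Or.inl ⟨c, eq_starGraph_of_degree_eq_one (hdom c hc) fun v hv => by rw [hrest v hv, hd1]⟩
  obtain ⟨y, hy⟩ : ∃ y, y ≠ c := by
    have : Nontrivial V := Fintype.one_lt_card_iff_nontrivial.mp (by omega)
    exact exists_ne c
  obtain ⟨z, hz, hzc⟩ : ∃ z ∈ G.neighborFinset y, z ≠ c :=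
    Finset.exists_mem_ne (by rw [card_neighborFinset_eq_degree, hrest y hy]; omega) c
  rw [mem_neighborFinset] at hz
  -- The classes of `y` and `z` are disjoint, avoid `c`, and each have `N + 1 - d` vertices.
  have hbound : 2 * (N + 1 - d) ≤ N := by
    have h1 := degree_add_card_not_adj G y
    have h2 := degree_add_card_not_adj G z
    have h3 : #(({w | ¬ G.Adj y w} : Finset V) ∪ ({w | ¬ G.Adj z w} : Finset V))
        ≤ #(univ.erase c) := by
      refine card_le_card fun w hw => ?_
      rw [mem_erase]
      refine ⟨?_, mem_univ w⟩
      rintro rfl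
      have h4 := (hdom w hc y hy).symm
      have h5 := (hdom w hc z hzc).symm
      simp [h4, h5] at hw
    rw [card_union_of_disjoint (hM.disjoint_not_adj hz), card_erase_of_mem (mem_univ c),
      card_univ] at h3
    rw [hrest y hy] at h1
    rw [hrest z hzc] at h2
    omega
  have hdN : d < N := by omega
  have hkey := mul_le_of_dominating h hN hdN hcN hrest
  obtain ⟨k, rfl⟩ : ∃ k, N = d + k := ⟨N - d, by omega⟩
  obtain ⟨e, rfl⟩ : ∃ e, d = e + 1 := ⟨d - 1, by omega⟩
  have hkey' : k * e ≤ e + 1 + k := by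
    push_cast at hkey
    have : (k : ℝ) * e ≤ e + 1 + k := by linarith
    exact_mod_cast this
  -- With `k = N - d` and `e = d - 1`, `hkey'` says `(k - 1)(e - 1) ≤ 2`, while `hbound` gives `e ≥
  -- k + 1`. Hence `k (k - 1) ≤ 2`, so `k = 2` and `e = 3`.
  have hk : 2 ≤ k := by omega
  have hek : k + 1 ≤ e := by omega
  have hk2 : k = 2 := by nlinarith
  subst hk2
  have he : e = 3 := by omega
  subst he
  exact Or.inr (Or.inr (Or.inl (nonempty_iso_one_three_three hM (by omega) (hdom c hc) hrest)))

end Forward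

/-! ### The listed graphs attain equality -/

section Backward

variable {V : Type*} [Fintype V] [DecidableEq V] {G : SimpleGraph V} [DecidableRel G.Adj]

theorem shiftedForm_self_of_fiber {ι : Type*} [Fintype ι] [DecidableEq ι] {f : V → ι}
    (hf : ∀ a b, G.Adj a b ↔ f a ≠ f b) (d : ℝ) (x : V → ℝ) :
    G.shiftedForm d x x = (∑ u, x u) ^ 2 - ∑ i, (∑ u with f u = i, x u) ^ 2
      + ∑ i, ∑ u with f u = i, (G.degree u - d) * x u ^ 2 := by
  have h1 : ∑ i, (∑ u with f u = i, x u) ^ 2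
      = ∑ u, ∑ v, if f v = f u then x u * x v else 0 := by
    rw [← Finset.sum_fiberwise univ f]
    refine Finset.sum_congr rfl fun i _ => ?_
    rw [sq, Finset.sum_mul]
    refine Finset.sum_congr rfl fun u hu => ?_
    rw [(mem_filter.mp hu).2, Finset.mul_sum, Finset.sum_filter]
  rw [shiftedForm_eq_sum, Finset.sum_fiberwise, h1, sq, Finset.sum_mul_sum,
    ← Finset.sum_sub_distrib]
  congr 1
  · refine Finset.sum_congr rfl fun u _ => ?_
    rw [← Finset.sum_sub_distrib]
    refine Finset.sum_congr rfl fun v _ => ?_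
    by_cases h : f v = f u
    · simp [hf, h]
    · simp [hf, h, Ne.symm h]
  · exact Finset.sum_congr rfl fun u _ => by ring

/-- On the hyperplane of vectors with sum zero, the square of the total sum vanishes and the form
splits over the classes. -/
theorem signlessLapSecond_le_of_fiber (hG : G ≠ ⊤) {ι : Type*} [Fintype ι] [DecidableEq ι]
    {f : V → ι} (hf : ∀ a b, G.Adj a b ↔ f a ≠ f b) {d : ℝ}
    (h : ∀ (x : V → ℝ) (i : ι),
      ∑ u with f u = i, (G.degree u - d) * x u ^ 2 ≤ (∑ u with f u = i, x u) ^ 2) :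
    G.signlessLapSecond hG ≤ d := by
  refine G.signlessLapSecond_le_of_forall_ker hG (∑ u, LinearMap.proj u) fun x hx => ?_
  have hx0 : ∑ u, x u = 0 := by simpa using hx
  rw [shiftedForm_self_of_fiber hf, hx0]
  have := Finset.sum_le_sum fun i (_ : i ∈ univ) => h x i
  linarith

theorem signlessLapSecond_le_of_regular (hG : G ≠ ⊤) (hM : G.IsCompleteMultipartite) {d : ℕ}
    (hd : G.IsRegularOfDegree d) : G.signlessLapSecond hG ≤ d := by
  obtain ⟨r, f, -, hf⟩ := hM.exists_fin_fiber
  refine signlessLapSecond_le_of_fiber hG hf fun x i => ?_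
  simp only [hd.degree_eq, sub_self, zero_mul, Finset.sum_const_zero]
  exact sq_nonneg _

theorem signlessLapSecond_le_of_sizes_one_or_two (hG : G ≠ ⊤) {r : ℕ} {n : Fin r → ℕ}
    (hn : ∀ i, n i = 1 ∨ n i = 2) (e : G ≃g completeMultipartiteOfSizes n) :
    G.signlessLapSecond hG ≤ G.minDegree := by
  obtain ⟨f, hf, hcard⟩ := exists_fiber_of_iso e
  have h1 := one_lt_card_of_ne_top hG
  have : Nonempty V := Fintype.card_pos_iff.mp (by omega)
  have hmin : Fintype.card V - 2 ≤ G.minDegree := by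
    refine G.le_minDegree_of_forall_le_degree _ fun v => ?_
    have := degree_add_card_fiber hf v
    rw [hcard] at this
    have := hn (f v)
    omega
  refine le_trans ?_ (Nat.cast_le.mpr hmin)
  refine signlessLapSecond_le_of_fiber hG hf fun x i => ?_
  -- Relative to `d = n - 2`, singleton classes have excess 1, which their own square absorbs; pairs
  -- have excess 0.
  have hdeg : ∀ u, f u = i → (G.degree u : ℝ) - (Fintype.card V - 2 : ℕ) = 2 - n i := by
    rintro u rfl
    have := degree_add_card_fiber hf u
    rw [hcard] at this
    rw [Nat.cast_sub (by omega), ← this]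
    push_cast
    ring
  rcases hn i with hi | hi
  · obtain ⟨w, hw⟩ := card_eq_one.mp ((hcard i).trans hi)
    have hwi : f w = i := by
      have hmem := mem_singleton_self w
      rw [← hw] at hmem
      exact (mem_filter.mp hmem).2
    rw [hw, Finset.sum_singleton, Finset.sum_singleton, hdeg w hwi, hi]
    norm_num
  · rw [Finset.sum_eq_zero]
    · exact sq_nonneg _
    · intro u hu
      rw [hdeg u (mem_filter.mp hu).2, hi]
      norm_num

theorem signlessLapSecond_le_of_one_three_three (hG : G ≠ ⊤)
    (e : G ≃g completeMultipartiteOfSizes ![1, 3, 3]) :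
    G.signlessLapSecond hG ≤ G.minDegree := by
  obtain ⟨f, hf, hcard⟩ := exists_fiber_of_iso e
  have h1 := one_lt_card_of_ne_top hG
  have : Nonempty V := Fintype.card_pos_iff.mp (by omega)
  have hV : Fintype.card V = 7 := by
    rw [← card_univ, card_eq_sum_card_fiberwise (f := f) (t := univ) (fun _ _ => by simp)]
    simp [hcard, Fin.sum_univ_three]
  have hdeg : ∀ u, G.degree u + (![1, 3, 3] : Fin 3 → ℕ) (f u) = 7 := by
    intro u
    rw [← hV, ← degree_add_card_fiber hf u, hcard]
  have hmin : 4 ≤ G.minDegree := by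
    refine G.le_minDegree_of_forall_le_degree _ fun v => ?_
    have := hdeg v
    generalize f v = i at this
    fin_cases i <;> simp at this <;> omega
  refine le_trans ?_ (Nat.cast_le.mpr hmin)
  -- The dominating vertex has excess `6 - 4 = 2`, too much for the classwise criterion. With class
  -- sums `S₀ + S₁ = 0`, the form is `S₂² - S₀² - S₁² - S₂² + 2 S₀² = 0`.
  refine G.signlessLapSecond_le_of_forall_ker hG
    (∑ u with f u = 0, LinearMap.proj u + ∑ u with f u = 1, LinearMap.proj u) fun x hx => ?_
  have hx0 : ∑ u with f u = 0, x u + ∑ u with f u = 1, x u = 0 := by simpa using hx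
  obtain ⟨w, hw⟩ := card_eq_one.mp (hcard 0)
  have hw0 : f w = 0 := by
      have hmem := mem_singleton_self w
      rw [← hw] at hmem
      exact (mem_filter.mp hmem).2
  have hwdeg : G.degree w = 6 := by
    have := hdeg w
    simp [hw0] at this
    omega
  have hz : ∀ i : Fin 3, i ≠ 0 →
      ∑ u with f u = i, ((G.degree u : ℝ) - (4 : ℕ)) * x u ^ 2 = 0 := by
    intro i hi
    refine Finset.sum_eq_zero fun u hu => ?_
    have h2 := hdeg u
    rw [(mem_filter.mp hu).2] at h2
    have h3 : G.degree u = 4 := by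
      fin_cases i <;> simp at h2 hi <;> omega
    simp [h3]
  rw [shiftedForm_self_of_fiber hf, ← Finset.sum_fiberwise univ f, Fin.sum_univ_three,
    Fin.sum_univ_three, Fin.sum_univ_three, hz 1 (by decide), hz 2 (by decide)]
  rw [hw, Finset.sum_singleton] at hx0 ⊢
  rw [Finset.sum_singleton, hwdeg]
  have hx1 : ∑ u with f u = 1, x u = -x w := by linarith
  rw [hx1]
  push_cast
  apply le_of_eq
  ring

theorem signlessLapSecond_le_of_starGraph {c : V} (hG : G ≠ ⊤) (h : G = starGraph c) :
    G.signlessLapSecond hG ≤ G.minDegree := by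
  have hadj : ∀ a b, G.Adj a b ↔ a ≠ b ∧ (a = c ∨ b = c) := by
    intro a b
    rw [h, starGraph_adj]
  have : Nontrivial V := Fintype.one_lt_card_iff_nontrivial.mp (one_lt_card_of_ne_top hG)
  have hdeg : ∀ v, v ≠ c → G.degree v = 1 := by
    intro v hv
    rw [← card_neighborFinset_eq_degree, card_eq_one]
    refine ⟨c, ?_⟩
    ext w
    rw [mem_neighborFinset, hadj, mem_singleton]
    grind
  have hmin : 1 ≤ G.minDegree := by
    refine G.le_minDegree_of_forall_le_degree _ fun v => ?_
    by_cases hv : v = c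
    · obtain ⟨w, hw⟩ := exists_ne c
      exact (G.degree_pos_iff_exists_adj v).mpr ⟨w, (hadj v w).mpr ⟨by grind, Or.inl hv⟩⟩
    · exact (hdeg v hv).ge
  refine le_trans ?_ (Nat.cast_le.mpr hmin)
  -- Every edge meets the centre, and leaves have excess 0, so the form vanishes once `x c = 0`.
  refine G.signlessLapSecond_le_of_forall_ker hG (LinearMap.proj c) fun x hx => ?_
  have hx0 : x c = 0 := hx
  rw [shiftedForm_eq_sum, Finset.sum_eq_zero, Finset.sum_eq_zero]
  · simp
  · intro u _
    by_cases hu : u = c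
    · simp [hu, hx0]
    · simp [hdeg u hu]
  · intro u _
    refine Finset.sum_eq_zero fun v _ => ?_
    split_ifs with huv
    · rcases ((hadj u v).mp huv).2 with rfl | rfl <;> simp [hx0]
    · rfl

theorem signlessLapSecond_le_of_card_edgeFinset_eq_one (hG : G ≠ ⊤)
    (h : #G.edgeFinset = 1) : G.signlessLapSecond hG ≤ G.minDegree := by
  refine le_trans ?_ (Nat.cast_nonneg _)
  obtain ⟨e, he⟩ := card_eq_one.mp h
  induction e with
  | _ u v =>
    have hadj : ∀ {a b}, G.Adj a b → a = u ∧ b = v ∨ a = v ∧ b = u := by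
      intro a b hab
      have : s(a, b) ∈ G.edgeFinset := mem_edgeFinset.mpr hab
      rwa [he, mem_singleton, Sym2.eq_iff] at this
    refine G.signlessLapSecond_le_of_forall_ker hG
      ((LinearMap.proj u : (V → ℝ) →ₗ[ℝ] ℝ) + LinearMap.proj v) fun x hx => ?_
    have hx0 : x u + x v = 0 := by simpa using hx
    rw [shiftedForm_eq_sum, ← Finset.sum_add_distrib]
    refine (Finset.sum_eq_zero fun a _ => ?_).le
    rw [G.degree_eq_sum_if_adj, sub_zero, Finset.sum_mul, ← Finset.sum_add_distrib]
    refine Finset.sum_eq_zero fun b _ => ?_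
    split_ifs with hab
    · rcases hadj hab with ⟨rfl, rfl⟩ | ⟨rfl, rfl⟩
      · linear_combination x a * hx0
      · linear_combination x a * hx0
    · simp

end Backward

end SimpleGraph

theorem theorem3 {V : Type*} [Fintype V] [DecidableEq V] (G : SimpleGraph V)
    [DecidableRel G.Adj] (hG : G ≠ ⊤) :
    (G.minDegree : ℝ) ≤ G.signlessLapSecond hG ∧
    (G.signlessLapSecond hG = (G.minDegree : ℝ) ↔
      -- a star
      (∃ c : V, G = SimpleGraph.starGraph c) ∨
      -- a regular complete multipartite graph
      (G.IsCompleteMultipartite ∧ ∃ d : ℕ, G.IsRegularOfDegree d) ∨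
      -- the graph `K_{1,3,3}`
      Nonempty (G ≃g SimpleGraph.completeMultipartiteOfSizes ![1, 3, 3]) ∨
      -- a complete multipartite graph `K_{1,…,1,2,…,2}`
      (∃ (r : ℕ) (n : Fin r → ℕ), (∀ i, n i = 1 ∨ n i = 2) ∧
        Nonempty (G ≃g SimpleGraph.completeMultipartiteOfSizes n)) ∨
      -- the degenerate case of a single edge together with isolated vertices
      G.edgeFinset.card = 1) := by
  have hle := G.minDegree_le_signlessLapSecond hG
  have hne : Nonempty V :=
    Fintype.card_pos_iff.mp ((SimpleGraph.one_lt_card_of_ne_top hG).trans' one_pos)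
  refine ⟨hle, fun h => ?_, fun h => le_antisymm ?_ hle⟩
  -- Minimum degree 0 is separate because isolated vertices defeat the multipartite argument, as one
  -- edge plus isolated vertices shows.
  · rcases Nat.eq_zero_or_pos G.minDegree with h0 | hpos
    · rw [h0] at h
      rcases SimpleGraph.eq_bot_or_card_edgeFinset_eq_one h.le with rfl | h1
      · exact Or.inr (Or.inl ⟨SimpleGraph.bot_isCompleteMultipartite, 0, fun v => by simp⟩)
      · exact Or.inr (Or.inr (Or.inr (Or.inr h1)))
    · rcases SimpleGraph.classification_of_second_le_of_pos h.le hpos G.minDegree_le_degree with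
        h1 | h1 | h1 | h1
      · exact Or.inl h1
      · exact Or.inr (Or.inl h1)
      · exact Or.inr (Or.inr (Or.inl h1))
      · exact Or.inr (Or.inr (Or.inr (Or.inl h1)))
  · rcases h with ⟨c, hc⟩ | ⟨hM, d, hd⟩ | ⟨⟨e⟩⟩ | ⟨r, n, hn, ⟨e⟩⟩ | h1
    · exact SimpleGraph.signlessLapSecond_le_of_starGraph hG hc
    · rw [hd.minDegree_eq]
      exact SimpleGraph.signlessLapSecond_le_of_regular hG hM hd
    · exact SimpleGraph.signlessLapSecond_le_of_one_three_three hG e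
    · exact SimpleGraph.signlessLapSecond_le_of_sizes_one_or_two hG hn e
    · exact SimpleGraph.signlessLapSecond_le_of_card_edgeFinset_eq_one hG h1
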